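/- **Definitions.** *3SAT*: given a conjunction of finitely many clauses, each a disjunction of three literals (variables may be repeated within a clause), is there a truth assignment satisfying all clauses? For a number $K$, a distribution is a probability distribution $p$ on $\{0,1\}^K$; an itemset is a subset $B$ of the $K$ coordinates (items), and its frequency under $p$ is $p(B=1)$, the probability that all coordinates in $B$ equal $1$. A family of itemsets is antimonotonic if it contains all subsets of each of its members. *MaxQueryDec*: given $K$, an antimonotonic family $\mathcal F=\{B_1,\dots,B_N\}$ of itemsets, rational frequencies $\theta_1,\dots,\theta_N$ that are consistent (some distribution $p$ satisfies $p(B_i=1)=\theta_i$ for all $i$), an itemset $B$ and a rational threshold $b$, is there a distribution $q$ with $q(B_i=1)=\theta_i$ for $i=1,\dots,N$ and $q(B=1)>b$? Numbers are written in binary, finite sets are given by listing their members. **Theorem.** 3SAT is polynomial-time (many-one) reducible to MaxQueryDec: there is a function, computable by a Turing machine in time polynomial in the length of its input, that maps every 3SAT formula $R$ to an instance of MaxQueryDec (in particular, with an antimonotonic family and consistent frequencies) such that $R$ is satisfiable if and only if the answer to that instance is yes. -/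

import Mathlib

open Computability (Γ')

/-! ### Strings over a finite alphabet -/

/-- `e` is uniquely decodable in front of any continuation. -/
def SelfDelimiting {α : Type} (e : α → List Γ') : Prop :=
  ∀ (a b : α) (s t : List Γ'), e a ++ s = e b ++ t → a = b ∧ s = t

/-- Binary digits, least significant first, closed by a comma. -/
def encNat (n : ℕ) : List Γ' :=
  (Computability.encodeNat n).map Γ'.bit ++ [Γ'.comma]

/-- Sign bit, then the absolute value in binary. -/
def encInt (z : ℤ) : List Γ' :=
  Γ'.bit (decide (z < 0)) :: encNat z.natAbs

/-- Numerator and denominator (in lowest terms) in binary. -/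
def encRat (q : ℚ) : List Γ' :=
  encInt q.num ++ encNat q.den

/-- The entries one after the other, each announced by `bra`; the list is closed by `ket`. -/
def encList {α : Type} (e : α → List Γ') (l : List α) : List Γ' :=
  l.flatMap (fun a => Γ'.bra :: e a) ++ [Γ'.ket]

theorem SelfDelimiting.injective {α : Type} {e : α → List Γ'} (h : SelfDelimiting e) :
    Function.Injective e := fun a b hab => (h a b [] [] (by rw [hab])).1

theorem selfDelimiting_encNat : SelfDelimiting encNat := by
  have key : ∀ (l m : List Bool) (s t : List Γ'),
      l.map Γ'.bit ++ Γ'.comma :: s = m.map Γ'.bit ++ Γ'.comma :: t → l = m ∧ s = t := by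
    intro l
    induction l with
    | nil => intro m s t h; cases m <;> simp_all
    | cons x l ih =>
      intro m s t h
      cases m with
      | nil => simp at h
      | cons y m =>
        simp only [List.map_cons, List.cons_append, List.cons.injEq, Γ'.bit.injEq] at h
        obtain ⟨h1, h2⟩ := ih m s t h.2
        exact ⟨by rw [h.1, h1], h2⟩
  intro a b s t h
  obtain ⟨h1, h2⟩ := key _ _ s t (by simpa [encNat] using h)
  refine ⟨?_, h2⟩
  rw [← Computability.decode_encodeNat a, h1, Computability.decode_encodeNat]

theorem selfDelimiting_encInt : SelfDelimiting encInt := by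
  intro a b s t h
  simp only [encInt, List.cons_append, List.cons.injEq, Γ'.bit.injEq] at h
  obtain ⟨h1, h2⟩ := selfDelimiting_encNat _ _ _ _ h.2
  have h3 : (a < 0 ↔ b < 0) := by simpa using h.1
  exact ⟨by omega, h2⟩

theorem selfDelimiting_encRat : SelfDelimiting encRat := by
  intro a b s t h
  simp only [encRat, List.append_assoc] at h
  obtain ⟨h1, h2⟩ := selfDelimiting_encInt _ _ _ _ h
  obtain ⟨h3, h4⟩ := selfDelimiting_encNat _ _ _ _ h2
  exact ⟨Rat.ext h1 h3, h4⟩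

theorem SelfDelimiting.encList {α : Type} {e : α → List Γ'} (he : SelfDelimiting e) :
    SelfDelimiting (encList e) := by
  intro l
  induction l with
  | nil => intro m s t h; cases m <;> simp_all [_root_.encList]
  | cons x l ih =>
    intro m s t h
    cases m with
    | nil => simp [_root_.encList] at h
    | cons y m =>
      simp only [_root_.encList, List.flatMap_cons, List.cons_append, List.append_assoc,
        List.cons.injEq, true_and] at h
      obtain ⟨h1, h2⟩ := he _ _ _ _ h
      obtain ⟨h3, h4⟩ := ih m s t (by simpa [_root_.encList] using h2)
      exact ⟨by rw [h1, h3], h4⟩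

/-! ### Decision problems and polynomial-time many-one reductions -/

/-- A decision problem: its admissible instances, how they are written down over a finite
alphabet, and which of them are yes-instances. -/
structure DecisionProblem where
  Instance : Type
  Alphabet : Type
  finite_alphabet : Finite Alphabet
  encode : Instance → List Alphabet
  encode_injective : Function.Injective encode
  Yes : Instance → Prop

/-- Polynomial-time many-one reducibility: some function, computed within polynomially many steps
(in the length of the input string) by a multi-stack Turing machine with finite alphabets, maps
instances of `P` to instances of `Q` and preserves and reflects the answer "yes". -/
def PolyTimeReducible (P Q : DecisionProblem) : Prop :=
  ∃ (f : P.Instance → Q.Instance)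
    (M : Turing.TM2ComputableInPolyTime P.encode Q.encode f),
    (∀ k, Finite (M.tm.Γ k)) ∧ ∀ x, P.Yes x ↔ Q.Yes (f x)

/-! ### 3SAT -/

/-- A literal: a propositional variable (`pos = true`) or its negation (`pos = false`). -/
structure Literal where
  var : ℕ
  pos : Bool

/-- A disjunction of three literals; repeated variables are allowed. -/
structure Clause3 where
  fst : Literal
  snd : Literal
  thd : Literal

/-- A conjunction of clauses with three literals each. -/
abbrev Formula3 := List Clause3

/-- The literal is true under the truth assignment `t`. -/
def Literal.Holds (t : ℕ → Bool) (l : Literal) : Prop := t l.var = l.pos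

/-- The clause is satisfied by the truth assignment `t`. -/
def Clause3.Holds (t : ℕ → Bool) (c : Clause3) : Prop :=
  c.fst.Holds t ∨ c.snd.Holds t ∨ c.thd.Holds t

/-- Some truth assignment satisfies all clauses. -/
def Formula3.Satisfiable (φ : Formula3) : Prop :=
  ∃ t : ℕ → Bool, ∀ c ∈ φ, c.Holds t

def encLiteral (l : Literal) : List Γ' := Γ'.bit l.pos :: encNat l.var

def encClause3 (c : Clause3) : List Γ' := encLiteral c.fst ++ encLiteral c.snd ++ encLiteral c.thd

theorem selfDelimiting_encLiteral : SelfDelimiting encLiteral := by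
  rintro ⟨v, p⟩ ⟨w, q⟩ s t h
  simp only [encLiteral, List.cons_append, List.cons.injEq, Γ'.bit.injEq] at h
  obtain ⟨h1, h2⟩ := selfDelimiting_encNat _ _ _ _ h.2
  exact ⟨by rw [h.1, h1], h2⟩

theorem selfDelimiting_encClause3 : SelfDelimiting encClause3 := by
  rintro ⟨a, b, c⟩ ⟨a', b', c'⟩ s t h
  simp only [encClause3, List.append_assoc] at h
  obtain ⟨rfl, h1⟩ := selfDelimiting_encLiteral _ _ _ _ h
  obtain ⟨rfl, h2⟩ := selfDelimiting_encLiteral _ _ _ _ h1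
  obtain ⟨rfl, h3⟩ := selfDelimiting_encLiteral _ _ _ _ h2
  exact ⟨rfl, h3⟩

/-- The satisfiability problem for conjunctions of three-literal clauses. -/
def ThreeSAT : DecisionProblem where
  Instance := Formula3
  Alphabet := Γ'
  finite_alphabet := inferInstance
  encode := encList encClause3
  encode_injective := selfDelimiting_encClause3.encList.injective
  Yes := Formula3.Satisfiable

/-! ### Itemset frequencies -/

/-- Probability distributions on the sample space of binary vectors of length `K`. -/
def distributions (K : ℕ) : Set ((Fin K → Bool) → ℝ) := stdSimplex ℝ (Fin K → Bool)

/-- The frequency of the itemset `S` under `p`: the probability that all items of `S` are `1`. -/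
def frequency {K : ℕ} (p : (Fin K → Bool) → ℝ) (S : Finset (Fin K)) : ℝ :=
  ∑ ω with ∀ i ∈ S, ω i = true, p ω

/-- The itemset presented by a list of item numbers below `K`. -/
def itemset (K : ℕ) (l : List ℕ) : Finset (Fin K) :=
  Finset.univ.filter fun i => (i : ℕ) ∈ l

/-- A family of itemsets over the items `0, …, K - 1` with a rational number for each member,
a query itemset and a rational threshold. Finite sets are presented by listing their members. -/
structure QueryData where
  K : ℕ
  family : List (List ℕ × ℚ)
  query : List ℕ
  threshold : ℚ

namespace QueryData

/-- The family of itemsets. -/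
def members (D : QueryData) : Set (Finset (Fin D.K)) :=
  {S | ∃ e ∈ D.family, S = itemset D.K e.1}

/-- The distribution `p` satisfies the given frequencies. -/
def Satisfies (D : QueryData) (p : (Fin D.K → Bool) → ℝ) : Prop :=
  ∀ e ∈ D.family, frequency p (itemset D.K e.1) = (e.2 : ℝ)

/-- Only existing items are used, the family is antimonotonic (closed under subsets), and the
frequencies are consistent (some distribution satisfies them). -/
structure Admissible (D : QueryData) : Prop where
  family_lt : ∀ e ∈ D.family, ∀ i ∈ e.1, i < D.K
  query_lt : ∀ i ∈ D.query, i < D.K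
  antimonotonic : ∀ S ∈ D.members, ∀ T ⊆ S, T ∈ D.members
  consistent : ∃ p ∈ distributions D.K, D.Satisfies p

/-- Some distribution satisfying the frequencies gives the query a frequency larger than the
threshold. -/
def Exceeds (D : QueryData) : Prop :=
  ∃ p ∈ distributions D.K, D.Satisfies p ∧ (D.threshold : ℝ) < frequency p (itemset D.K D.query)

def encEntry (e : List ℕ × ℚ) : List Γ' := encList encNat e.1 ++ encRat e.2

def enc (D : QueryData) : List Γ' :=
  encNat D.K ++ encList encEntry D.family ++ encList encNat D.query ++ encRat D.threshold

theorem selfDelimiting_encEntry : SelfDelimiting encEntry := by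
  rintro ⟨a, b⟩ ⟨a', b'⟩ s t h
  simp only [encEntry, List.append_assoc] at h
  obtain ⟨rfl, h1⟩ := selfDelimiting_encNat.encList _ _ _ _ h
  obtain ⟨rfl, h2⟩ := selfDelimiting_encRat _ _ _ _ h1
  exact ⟨rfl, h2⟩

theorem selfDelimiting_enc : SelfDelimiting enc := by
  rintro ⟨a, b, c, d⟩ ⟨a', b', c', d'⟩ s t h
  simp only [enc, List.append_assoc] at h
  obtain ⟨rfl, h1⟩ := selfDelimiting_encNat _ _ _ _ h
  obtain ⟨rfl, h2⟩ := selfDelimiting_encEntry.encList _ _ _ _ h1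
  obtain ⟨rfl, h3⟩ := selfDelimiting_encNat.encList _ _ _ _ h2
  obtain ⟨rfl, h4⟩ := selfDelimiting_encRat _ _ _ _ h3
  exact ⟨rfl, h4⟩

end QueryData

/-- Given an antimonotonic family with rational and consistent frequencies, an itemset and a
rational threshold, can the itemset have a frequency larger than the threshold? -/
def MaxQueryDec : DecisionProblem where
  Instance := {D : QueryData // D.Admissible}
  Alphabet := Γ'
  finite_alphabet := inferInstance
  encode D := D.1.enc
  encode_injective := QueryData.selfDelimiting_enc.injective.comp Subtype.val_injective
  Yes D := D.1.Exceeds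

/-! The instance simulates a circuit of ternary gates driven by fair coins. Every variable has three
copies, each an item with its own coin. A variable gate tests whether the copies agree; a clause
gate evaluates its clause, reading the `j`-th copy for the `j`-th literal. So a gate reads three
different coins even if a variable is repeated, and no gate reads an output. The family consists of
all subsets of the four items of each gate, with their frequencies under the joint law `gateLaw` of
coins and outputs; hence it is antimonotonic and consistent. These frequencies are multiples of 1/8
that depend only on the gate (`frequency_gateLaw_gate`). The query is the set of all outputs, the
threshold is 0.

A satisfying assignment, used as coin values, makes all outputs 1, and this outcome has positive
probability under `gateLaw`. Conversely, the frequencies of all subsets of an itemset determine the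
marginal on it by inclusion-exclusion, so a distribution with these frequencies charges only
outcomes in which every gate works (`gate_of_frequency_eq`). A charged outcome with all outputs 1
has equal copies and true clauses, and one copy of each variable is a satisfying assignment.

For the running time, items are not numbered consecutively: the digits of an item number spell out a
name, and `K` is a power of two above all these numbers, exponentially large but short in binary.
What a clause contributes is a template that depends only on its three signs, with the escaped
digits of its variables copied in, and linear time suffices. The machine is written in the small
language `Prog`; `Run.steps` transfers step counts to the compiled machine. -/

/-! ### A structured stack language and its compilation to multi-stack machines -/

/-- Programs over stacks indexed by `κ`. `pop` and `loop` remove the top symbol of a stack and pass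
it on; `loop` repeats until the popped symbol passes the test `exit`. -/
inductive Prog (κ : Type) : Type
  | skip : Prog κ
  | push (k : κ) (a : Γ') : Prog κ
  | seq (P Q : Prog κ) : Prog κ
  | pop (k : κ) (f : Option Γ' → Prog κ) : Prog κ
  | loop (k : κ) (exit : Option Γ' → Bool) (f : Option Γ' → Prog κ) : Prog κ

namespace Prog

variable {κ : Type}

/-- The control points of a program. -/
def Lab : Prog κ → Type
  | skip => Empty
  | push _ _ => Unit
  | seq P Q => Lab P ⊕ Lab Q
  | pop _ f => Option (Σ a, Lab (f a))
  | loop _ _ f => Option (Σ a, Lab (f a))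

instance finite_lab : ∀ P : Prog κ, Finite (Lab P)
  | skip => inferInstanceAs (Finite Empty)
  | push _ _ => inferInstanceAs (Finite Unit)
  | seq P Q =>
    have := finite_lab P
    have := finite_lab Q
    inferInstanceAs (Finite (Lab P ⊕ Lab Q))
  | pop _ f =>
    have := fun a => finite_lab (f a)
    inferInstanceAs (Finite (Option (Σ a, Lab (f a))))
  | loop _ _ f =>
    have := fun a => finite_lab (f a)
    inferInstanceAs (Finite (Option (Σ a, Lab (f a))))

/-- The first control point, or `none` if the program ends at once. -/
def start : (P : Prog κ) → Option (Lab P)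
  | skip => none
  | push _ _ => some ()
  | seq P Q => ((start P).map Sum.inl).or ((start Q).map Sum.inr)
  | pop _ _ => some none
  | loop _ _ _ => some none

/-- The statement at a control point, where `e` places the control points and the exit `none`
among the labels of the machine. -/
def code {L : Type} : (P : Prog κ) → (Option (Lab P) → L) → Lab P →
    Turing.TM2.Stmt (fun _ : κ => Γ') L (Option Γ')
  | skip, _, l => nomatch l
  | push k a, e, _ => .push k (fun _ => a) (.goto fun _ => e none)
  | seq P Q, e, .inl l =>
    code P (fun o => e ((o.map Sum.inl).or ((start Q).map Sum.inr))) l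
  | seq _ Q, e, .inr l => code Q (fun o => e (o.map Sum.inr)) l
  | pop k f, e, none =>
    .pop k (fun _ a => a) (.goto fun a => e ((start (f a)).map fun l => some ⟨a, l⟩))
  | pop _ f, e, some ⟨a, l⟩ => code (f a) (fun o => e (o.map fun l => some ⟨a, l⟩)) l
  | loop k exit f, e, none =>
    .pop k (fun _ a => a) (.goto fun a =>
      -- The outer `some` sends an empty body back to the loop head `some none` instead of to the
      -- exit.
      if exit a then e none else e (some ((start (f a)).map fun l => ⟨a, l⟩)))
  | loop _ _ f, e, some ⟨a, l⟩ => code (f a) (fun o => e (some (o.map fun l => ⟨a, l⟩))) l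

/-! ### Step-counting semantics and its simulation by machines. -/

variable [DecidableEq κ]

/-- `Run P S T n`: started on the stacks `S`, the program `P` ends after `n` steps with stacks
`T`. -/
inductive Run : Prog κ → (κ → List Γ') → (κ → List Γ') → ℕ → Prop
  | skip (S) : Run skip S S 0
  | push (k a S) : Run (push k a) S (Function.update S k (a :: S k)) 1
  | seq {P Q S T U m n} : Run P S T m → Run Q T U n → Run (seq P Q) S U (m + n)
  | pop {k f S T n} :
    Run (f (S k).head?) (Function.update S k (S k).tail) T n → Run (pop k f) S T (1 + n)
  | loop_last {k exit f S} : exit (S k).head? = true →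
    Run (loop k exit f) S (Function.update S k (S k).tail) 1
  | loop_next {k exit f S T U m n} : exit (S k).head? = false →
    Run (f (S k).head?) (Function.update S k (S k).tail) T m → Run (loop k exit f) T U n →
    Run (loop k exit f) S U (1 + m + n)

/-- `n` steps of the machine lead from `c` to `d`. -/
def Steps {L : Type} (M : L → Turing.TM2.Stmt (fun _ : κ => Γ') L (Option Γ')) (n : ℕ)
    (c d : Turing.TM2.Cfg (fun _ : κ => Γ') L (Option Γ')) : Prop :=
  (flip bind (Turing.TM2.step M))^[n] (some c) = some d

theorem Steps.trans {L : Type} {M : L → Turing.TM2.Stmt (fun _ : κ => Γ') L (Option Γ')}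
    {m n : ℕ} {c d e : Turing.TM2.Cfg (fun _ : κ => Γ') L (Option Γ')}
    (h₁ : Steps M m c d) (h₂ : Steps M n d e) : Steps M (m + n) c e := by
  unfold Steps at *
  rw [Nat.add_comm, Function.iterate_add_apply, h₁, h₂]

theorem Steps.one {L : Type} {M : L → Turing.TM2.Stmt (fun _ : κ => Γ') L (Option Γ')}
    {l : L} {q : Turing.TM2.Stmt (fun _ : κ => Γ') L (Option Γ')} {v : Option Γ'}
    {S : κ → List Γ'} {d : Turing.TM2.Cfg (fun _ : κ => Γ') L (Option Γ')}
    (hq : M l = q) (h : Turing.TM2.stepAux q v S = d) : Steps M 1 ⟨some l, v, S⟩ d := by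
  subst hq h
  rfl

/-- Induction on the run rather than on the program covers loops. The placement `e` is arbitrary
because a subprogram is compiled with a composed placement; the register `v` is arbitrary because it
is overwritten before each branching. -/
theorem Run.steps {L : Type} {M : L → Turing.TM2.Stmt (fun _ : κ => Γ') L (Option Γ')}
    {P : Prog κ} {S T : κ → List Γ'} {n : ℕ} (h : Run P S T n) :
    ∀ (e : Option (Lab P) → L), (∀ l, M (e (some l)) = code P e l) → ∀ v, ∃ w,
      Steps M n ⟨some (e (start P)), v, S⟩ ⟨some (e none), w, T⟩ := by
  induction h with
  | skip S => exact fun e _ v => ⟨v, rfl⟩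
  | push k a S =>
    intro e he v
    exact ⟨v, .one (he ()) rfl⟩
  | @seq P Q S T U m n h₁ h₂ ih₁ ih₂ =>
    intro e he v
    obtain ⟨w, hw⟩ := ih₁ (fun o => e ((o.map Sum.inl).or ((start Q).map Sum.inr)))
      (fun l => he (.inl l)) v
    obtain ⟨w', hw'⟩ := ih₂ (fun o => e (o.map Sum.inr)) (fun l => he (.inr l)) w
    exact ⟨w', hw.trans hw'⟩
  | @pop k f S T n h ih =>
    intro e he v
    obtain ⟨w, hw⟩ := ih (fun o => e (o.map fun l => some ⟨_, l⟩)) (fun l => he (some ⟨_, l⟩))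
      (S k).head?
    exact ⟨w, Steps.trans (.one (he none) rfl) hw⟩
  | @loop_last k exit f S h =>
    intro e he v
    exact ⟨(S k).head?, .one (he none) (by simp [code, h])⟩
  | @loop_next k exit f S T U m n h h₁ h₂ ih₁ ih₂ =>
    intro e he v
    obtain ⟨w, hw⟩ := ih₁ (fun o => e (some (o.map fun l => ⟨_, l⟩))) (fun l => he (some ⟨_, l⟩))
      (S k).head?
    obtain ⟨w', hw'⟩ := ih₂ e he w
    exact ⟨w', Steps.trans (Steps.trans (.one (he none) (by simp [code, h])) hw) hw'⟩

/-- The machine that runs `P` with input on stack `i` and output on stack `o`. -/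
noncomputable def machine [Fintype κ] (P : Prog κ) (i o : κ) : Turing.FinTM2 where
  K := κ
  k₀ := i
  k₁ := o
  Γ := fun _ => Γ'
  Λ := Option (Lab P)
  main := start P
  ΛFin := Fintype.ofFinite _
  σ := Option Γ'
  initialState := none
  -- A halting configuration must carry the initial register value, so the exit resets it; this
  -- costs one extra step.
  m := fun l => l.elim (.load (fun _ => none) .halt) (code P id)
  Γk₀Fin := inferInstanceAs (Fintype Γ')

/-- The stack `k` holds `s`, all other stacks are empty. -/
def single (k : κ) (s : List Γ') (l : κ) : List Γ' := if l = k then s else []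

theorem machine_outputs [Fintype κ] {P : Prog κ} {i o : κ} {s t : List Γ'} {n m : ℕ}
    (h : Run P (single i s) (single o t) n) (hm : n + 1 ≤ m) :
    Nonempty (Turing.TM2OutputsInTime (machine P i o) s (some t) m) := by
  obtain ⟨w, hw⟩ := h.steps (M := (machine P i o).m) id (fun l => rfl) none
  refine ⟨⟨⟨n + 1, ?_⟩, hm⟩⟩
  have h₁ : Turing.initList (machine P i o) s = ⟨some (start P), none, single i s⟩ := by
    unfold Turing.initList
    congr 1
  have h₂ : Turing.haltList (machine P i o) t = ⟨none, none, single o t⟩ := by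
    unfold Turing.haltList
    congr 1
  have h₃ : Steps (machine P i o).m 1 ⟨some none, w, single o t⟩ ⟨none, none, single o t⟩ :=
    .one (q := .load (fun _ => none) .halt) rfl rfl
  rw [h₁]
  exact Eq.trans (hw.trans h₃) (congrArg some h₂.symm)

end Prog

/-! ### Distributions that agree on the subsets of an itemset -/

/-- The probability that all items of `A` are `1` and all items of `N` are `0`. -/
def cylinder {K : ℕ} (p : (Fin K → Bool) → ℝ) (A N : Finset (Fin K)) : ℝ :=
  ∑ ω with (∀ i ∈ A, ω i = true) ∧ ∀ i ∈ N, ω i = false, p ω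

/-- The event splits according to the value of item `k`. Disjointness is not needed: contradictory
events contribute 0. -/
theorem cylinder_insert {K : ℕ} (p : (Fin K → Bool) → ℝ) (A N : Finset (Fin K)) (k : Fin K) :
    cylinder p A (insert k N) = cylinder p A N - cylinder p (insert k A) N := by
  rw [eq_sub_iff_add_eq]
  simp only [cylinder, Finset.sum_filter, ← Finset.sum_add_distrib]
  refine Finset.sum_congr rfl fun ω _ => ?_
  simp only [Finset.forall_mem_insert]
  cases ω k <;> simp

/-- Inclusion-exclusion: required zeros are removed one at a time, at the price of moving the item
into `A`, until only frequencies remain. -/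
theorem cylinder_eq_of_frequency_eq {K : ℕ} {p q : (Fin K → Bool) → ℝ} {S : Finset (Fin K)}
    (h : ∀ T ⊆ S, frequency p T = frequency q T) (A N : Finset (Fin K)) (hA : A ⊆ S)
    (hN : N ⊆ S) : cylinder p A N = cylinder q A N := by
  induction N using Finset.induction_on generalizing A with
  | empty => simpa [cylinder, frequency] using h A hA
  | insert k N _ ih =>
    rw [Finset.insert_subset_iff] at hN
    rw [cylinder_insert, cylinder_insert, ih A hA hN.2,
      ih _ (Finset.insert_subset hN.1 hA) hN.2]

/-- If `q` charges `ω` and has the same frequencies as `p` on the subsets of `S`, then `p` charges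
some outcome that coincides with `ω` on `S`. -/
theorem exists_agree_of_frequency_eq {K : ℕ} {p q : (Fin K → Bool) → ℝ} {S : Finset (Fin K)}
    (hq : ∀ ω, 0 ≤ q ω) (h : ∀ T ⊆ S, frequency p T = frequency q T) {ω : Fin K → Bool}
    (hω : q ω ≠ 0) : ∃ ω', p ω' ≠ 0 ∧ ∀ i ∈ S, ω' i = ω i := by
  -- With the ones and the zeros of `ω` on `S`, the cylinder is the set of outcomes that agree with
  -- `ω` on `S`.
  have h₁ := cylinder_eq_of_frequency_eq h (S.filter fun i => ω i = true)
    (S.filter fun i => ω i = false) (Finset.filter_subset _ _) (Finset.filter_subset _ _)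
  have h₂ : 0 < cylinder q (S.filter fun i => ω i = true) (S.filter fun i => ω i = false) :=
    Finset.sum_pos' (fun _ _ => hq _) ⟨ω, by simp, lt_of_le_of_ne (hq ω) hω.symm⟩
  rw [← h₁] at h₂
  obtain ⟨ω', hm, hne⟩ := Finset.exists_ne_zero_of_sum_ne_zero h₂.ne'
  refine ⟨ω', hne, fun i hi => ?_⟩
  simp only [Finset.mem_filter, Finset.mem_univ, true_and] at hm
  cases hb : ω i
  · exact hm.2 i ⟨hi, hb⟩
  · exact hm.1 i ⟨hi, hb⟩

/-! ### Gates driven by fair coins -/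

/-- The proportion of the inputs of a ternary gate for which the selected ones among its output
(`none`) and its inputs (`some j`) are all `1`. -/
def gateFrequency (g : (Fin 3 → Bool) → Bool) (m : Option (Fin 3) → Bool) : ℚ :=
  (Finset.univ.filter fun x : Fin 3 → Bool =>
    ∀ o, m o = true → o.elim (g x) x = true).card / 8

/-- Three distinct coins split off as a factor of the product space. The multiplicative form avoids
the exponent `K - 3`. -/
theorem card_filter_comp {K : ℕ} {a : Fin 3 → Fin K} (ha : Function.Injective a)
    (P : (Fin 3 → Bool) → Prop) [DecidablePred P] :
    8 * (Finset.univ.filter fun u : Fin K → Bool => P fun j => u (a j)).card =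
      2 ^ K * (Finset.univ.filter P).card := by
  classical
  let e : (Fin K → Bool) ≃ (Fin 3 → Bool) × ({k // k ∉ Set.range a} → Bool) :=
    (Equiv.piEquivPiSubtypeProd (· ∈ Set.range a) fun _ => Bool).trans
      (Equiv.prodCongr ((Equiv.ofInjective a ha).arrowCongr (Equiv.refl Bool)).symm
        (Equiv.refl _))
  have he : ∀ u, (e u).1 = fun j => u (a j) := fun u => rfl
  have h₁ : (Finset.univ.filter fun u : Fin K → Bool => P fun j => u (a j)).card =
      (Finset.univ.filter P).card * Fintype.card ({k // k ∉ Set.range a} → Bool) := by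
    rw [← Finset.card_univ, ← Finset.card_product]
    refine Finset.card_equiv e fun u => ?_
    simp [he]
  have h₂ : 2 ^ K = 8 * Fintype.card ({k // k ∉ Set.range a} → Bool) := by
    have := Fintype.card_congr e
    rw [Fintype.card_prod] at this
    simpa using this
  rw [h₁, h₂]
  ring

section Gates

variable {K : ℕ} {ι : Type} (node : ι → Option (Fin 3) → Fin K)
  (gate : ι → (Fin 3 → Bool) → Bool)

open Classical in
/-- The output items show the values of their gates on the coins `u`; all other items show their
own coins. -/
noncomputable def response (u : Fin K → Bool) (k : Fin K) : Bool :=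
  decide ((∀ i, node i none = k → gate i (fun j => u (node i (some j))) = true) ∧
    ((∀ i, node i none ≠ k) → u k = true))

/-- The distribution of the response to fair coins. -/
noncomputable def gateLaw (ω : Fin K → Bool) : ℝ :=
  (Finset.univ.filter fun u => response node gate u = ω).card / 2 ^ K

theorem gateLaw_nonneg (ω : Fin K → Bool) : 0 ≤ gateLaw node gate ω := by
  unfold gateLaw; positivity

theorem exists_response_of_gateLaw_ne_zero {ω : Fin K → Bool} (h : gateLaw node gate ω ≠ 0) :
    ∃ u, response node gate u = ω := by
  contrapose! h
  simp [gateLaw, h]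

theorem frequency_gateLaw (S : Finset (Fin K)) : frequency (gateLaw node gate) S =
    (Finset.univ.filter fun u => ∀ k ∈ S, response node gate u k = true).card / 2 ^ K := by
  rw [Finset.card_eq_sum_card_fiberwise (f := response node gate)
    (t := Finset.univ.filter fun ω => ∀ k ∈ S, ω k = true) (fun u hu => by simpa using hu),
    frequency, Nat.cast_sum, Finset.sum_div]
  refine Finset.sum_congr rfl fun ω hω => ?_
  rw [gateLaw]
  congr 3
  ext u
  simp only [Finset.mem_filter, Finset.mem_univ, true_and] at hω ⊢
  exact ⟨fun h => ⟨h ▸ hω, h⟩, fun h => h.2⟩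

theorem gateLaw_mem_distributions : gateLaw node gate ∈ distributions K := by
  refine ⟨gateLaw_nonneg node gate, ?_⟩
  -- The total mass is the frequency of the empty itemset.
  have := frequency_gateLaw node gate ∅
  simpa [frequency] using this

variable {node} (hinj : ∀ i, Function.Injective (node i))
  (hout : ∀ i i', node i none = node i' none → i = i')
  (hsep : ∀ i i' j, node i none ≠ node i' (some j))

include hout in
theorem response_none (u : Fin K → Bool) (i : ι) :
    response node gate u (node i none) = gate i fun j => u (node i (some j)) := by
  rw [Bool.eq_iff_iff]
  simp only [response, decide_eq_true_eq]
  exact ⟨fun h => h.1 i rfl, fun h => ⟨fun i' hi' => by rw [hout _ _ hi']; exact h,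
    fun h' => absurd rfl (h' i)⟩⟩

include hsep in
theorem response_some (u : Fin K → Bool) (i : ι) (j : Fin 3) :
    response node gate u (node i (some j)) = u (node i (some j)) := by
  rw [Bool.eq_iff_iff]
  simp only [response, decide_eq_true_eq]
  exact ⟨fun h => h.2 fun i' => hsep _ _ _, fun h => ⟨fun i' hi' => absurd hi' (hsep _ _ _),
    fun _ => h⟩⟩

include hinj hout hsep in
-- By `hinj` the inputs are three independent coins, by `hsep` no gate overwrites them, and by
-- `hout` the output item obeys this gate alone. Other gates may share the inputs without any
-- effect.
theorem frequency_gateLaw_gate (i : ι) (m : Option (Fin 3) → Bool) (S : Finset (Fin K))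
    (hS : ∀ k, k ∈ S ↔ ∃ o, m o = true ∧ node i o = k) :
    frequency (gateLaw node gate) S = (gateFrequency (gate i) m : ℝ) := by
  have h := card_filter_comp (a := fun j => node i (some j))
    (fun j j' h => Option.some_injective _ (hinj i h))
    (fun x => ∀ o, m o = true → o.elim (gate i x) x = true)
  rw [frequency_gateLaw, gateFrequency]
  have h' : (Finset.univ.filter fun u : Fin K → Bool => ∀ k ∈ S, response node gate u k = true) =
      Finset.univ.filter fun u : Fin K → Bool => ∀ o, m o = true →
        o.elim (gate i fun j => u (node i (some j))) (fun j => u (node i (some j))) = true := by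
    ext u
    simp only [Finset.mem_filter, Finset.mem_univ, true_and, hS, forall_exists_index, and_imp]
    constructor
    · intro H o ho
      have := H _ o ho rfl
      cases o
      · rwa [response_none gate hout] at this
      · rwa [response_some gate hsep] at this
    · rintro H _ o ho rfl
      have := H o ho
      cases o
      · rwa [response_none gate hout]
      · rwa [response_some gate hsep]
  rw [h']
  push_cast
  rw [div_eq_div_iff (by positivity) (by norm_num)]
  have h8 := congrArg (Nat.cast : ℕ → ℝ) h
  push_cast at h8
  linarith

include hsep hout in
/-- A distribution with the frequencies of the gates only charges outcomes in which the gates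
work correctly. -/
theorem gate_of_frequency_eq {q : (Fin K → Bool) → ℝ} (hq : ∀ ω, 0 ≤ q ω) (i : ι)
    (h : ∀ T ⊆ Finset.univ.image (node i), frequency (gateLaw node gate) T = frequency q T)
    {ω : Fin K → Bool} (hω : q ω ≠ 0) :
    ω (node i none) = gate i fun j => ω (node i (some j)) := by
  -- `ω'` is a response, so the gate works in it; this depends only on the four items on which `ω`
  -- agrees with `ω'`.
  obtain ⟨ω', h₁, h₂⟩ := exists_agree_of_frequency_eq hq h hω
  obtain ⟨u, rfl⟩ := exists_response_of_gateLaw_ne_zero node gate h₁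
  simp only [Finset.mem_image, Finset.mem_univ, true_and, forall_exists_index,
    forall_apply_eq_imp_iff] at h₂
  have h₃ := h₂ none
  simp only [response_none gate hout] at h₃
  rw [← h₃]
  congr 1
  funext j
  rw [← h₂ (some j), response_some gate hsep]

end Gates

/-! ### Item numbers with prescribed binary digits -/

/-- The positive number whose digits, least significant first, are `w` followed by a one. -/
def bitsPos : List Bool → PosNum
  | [] => .one
  | false :: w => .bit0 (bitsPos w)
  | true :: w => .bit1 (bitsPos w)

/-- The number whose digits, least significant first, are `w` followed by a one. -/
def itemNumber (w : List Bool) : ℕ := bitsPos w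

/-- The final one protects trailing zeros of `w`, so a name appears literally in the encoding and
can be written by copying. -/
theorem encodeNat_itemNumber (w : List Bool) :
    Computability.encodeNat (itemNumber w) = w ++ [true] := by
  have h : ∀ w, Computability.encodePosNum (bitsPos w) = w ++ [true] := by
    intro w
    induction w with
    | nil => rfl
    | cons b w ih => cases b <;> simp [bitsPos, Computability.encodePosNum, ih]
  rw [Computability.encodeNat, itemNumber, PosNum.of_to_nat, Computability.encodeNum, h]

theorem encNat_itemNumber (w : List Bool) :
    encNat (itemNumber w) = w.map Γ'.bit ++ [Γ'.bit true, Γ'.comma] := by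
  simp [encNat, encodeNat_itemNumber]

theorem itemNumber_injective : Function.Injective itemNumber := by
  intro w w' h
  have := congrArg Computability.encodeNat h
  simpa [encodeNat_itemNumber] using this

theorem itemNumber_lt (w : List Bool) : itemNumber w < 2 ^ (w.length + 1) := by
  induction w with
  | nil => simp [itemNumber, bitsPos]
  | cons b w ih =>
    simp only [itemNumber, List.length_cons] at ih ⊢
    rw [pow_succ]
    cases b <;> simp only [bitsPos, PosNum.cast_bit0, PosNum.cast_bit1] <;> omega

/-- This lets `K` be written as a run of zeros and a one, without arithmetic. -/
theorem itemNumber_replicate (n : ℕ) : itemNumber (List.replicate n false) = 2 ^ n := by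
  induction n with
  | zero => rfl
  | succ n ih =>
    rw [itemNumber] at ih ⊢
    rw [List.replicate_succ, bitsPos, PosNum.cast_bit0, ih]
    omega

/-- The binary digits of `v`, each announced by `true`; the list is closed by `false`. -/
def escape (v : ℕ) : List Bool :=
  (Computability.encodeNat v).flatMap (fun b => [true, b]) ++ [false]

/-- Escaped numbers form a prefix code, so several can be concatenated in one name. -/
theorem escape_append_inj {v w : ℕ} {s t : List Bool} (h : escape v ++ s = escape w ++ t) :
    v = w ∧ s = t := by
  have key : ∀ (l m : List Bool) (s t : List Bool),
      l.flatMap (fun b => [true, b]) ++ false :: s = m.flatMap (fun b => [true, b]) ++ false :: t →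
        l = m ∧ s = t := by
    intro l
    induction l with
    | nil => intro m s t h; cases m <;> simp_all
    | cons x l ih =>
      intro m s t h
      cases m with
      | nil => simp at h
      | cons y m =>
        simp only [List.flatMap_cons, List.cons_append, List.nil_append, List.cons.injEq,
          true_and] at h
        obtain ⟨h1, h2⟩ := ih m s t h.2
        exact ⟨by rw [h.1, h1], h2⟩
  obtain ⟨h1, h2⟩ := key _ _ s t (by simpa [escape] using h)
  exact ⟨by rw [← Computability.decode_encodeNat v, h1, Computability.decode_encodeNat], h2⟩

theorem escape_injective : Function.Injective escape := fun v w h =>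
  (escape_append_inj (s := []) (t := []) (by rw [h])).1

theorem length_escape (v : ℕ) :
    (escape v).length = 2 * (Computability.encodeNat v).length + 1 := by
  simp [escape, List.length_flatMap, Nat.mul_comm]

/-! ### The gates of a formula -/

/-- The three literals of a clause. -/
def Clause3.lit (c : Clause3) : Fin 3 → Literal := ![c.fst, c.snd, c.thd]

/-- The signs of the literals of a clause. -/
def Clause3.signs (c : Clause3) (j : Fin 3) : Bool := (c.lit j).pos

/-- Every variable has three copies. A variable gate tests whether they are equal; a clause gate
evaluates the clause, reading the `j`-th copy of the variable of the `j`-th literal. -/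
abbrev Gadget := ℕ ⊕ Clause3

def equalGate (x : Fin 3 → Bool) : Bool := decide (x 0 = x 1 ∧ x 1 = x 2)

def clauseGate (s x : Fin 3 → Bool) : Bool := decide (∃ j, x j = s j)

namespace Gadget

def gate : Gadget → (Fin 3 → Bool) → Bool
  | .inl _ => equalGate
  | .inr c => clauseGate c.signs

/-- The leading `false` marks an input, as outputs start with `true`; the next two digits identify
the copy. -/
def copyWord (v : ℕ) (j : Fin 3) : List Bool :=
  false :: decide (j = 1) :: decide (j = 2) :: escape v

/-- The words that name the output (`none`) and the inputs (`some j`) of a gate. -/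
def word : Gadget → Option (Fin 3) → List Bool
  | .inl v, none => true :: false :: escape v
  | .inl v, some j => copyWord v j
  | .inr c, none => true :: true :: c.signs 0 :: c.signs 1 :: c.signs 2 ::
      (escape (c.lit 0).var ++ (escape (c.lit 1).var ++ escape (c.lit 2).var))
  | .inr c, some j => copyWord (c.lit j).var j

theorem copyWord_inj {v w : ℕ} {j k : Fin 3} (h : copyWord v j = copyWord w k) :
    v = w ∧ j = k := by
  simp only [copyWord, List.cons.injEq, true_and, decide_eq_decide] at h
  exact ⟨escape_injective h.2.2, by omega⟩

theorem word_none_ne (G G' : Gadget) (j : Fin 3) : G.word none ≠ G'.word (some j) := by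
  cases G <;> cases G' <;> simp [word, copyWord]

theorem word_injective (G : Gadget) : Function.Injective G.word := by
  intro o o' h
  match o, o' with
  | none, none => rfl
  | none, some j => exact absurd h (word_none_ne _ _ _)
  | some j, none => exact absurd h.symm (word_none_ne _ _ _)
  | some j, some k => cases G <;> exact congrArg some (copyWord_inj h).2

/-- The second digit tells variable gates from clause gates, and a clause output spells out all
signs and variables. Thus equal clauses share one gate, and different gates never share an output.
-/
theorem word_none_injective {G G' : Gadget} (h : G.word none = G'.word none) : G = G' := by
  match G, G' with
  | .inl v, .inl w => simpa [word, escape_injective.eq_iff] using h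
  | .inl v, .inr c => simp [word] at h
  | .inr c, .inl v => simp [word] at h
  | .inr ⟨⟨_, _⟩, ⟨_, _⟩, ⟨_, _⟩⟩, .inr ⟨⟨_, _⟩, ⟨_, _⟩, ⟨_, _⟩⟩ =>
    simp only [word, List.cons.injEq, true_and] at h
    obtain ⟨h₀, h₁, h₂, h⟩ := h
    obtain ⟨h₃, h⟩ := escape_append_inj h
    obtain ⟨h₄, h⟩ := escape_append_inj h
    have h₅ := escape_injective h
    simp only [Clause3.signs, Clause3.lit] at h₀ h₁ h₂ h₃ h₄ h₅
    simp_all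

end Gadget

/-- The gadgets of a clause: the clause itself and the variables of its literals. -/
def Clause3.gadget (c : Clause3) (o : Option (Fin 3)) : Gadget :=
  o.elim (.inr c) fun i => .inl (c.lit i).var

/-- A number of binary digits that suffices for all items of the gadgets of the clause. -/
def Clause3.size (c : Clause3) : ℕ :=
  16 + 2 * ((Computability.encodeNat (c.lit 0).var).length +
    (Computability.encodeNat (c.lit 1).var).length + (Computability.encodeNat (c.lit 2).var).length)

/-- Escaping doubles the digits, and the longest name, that of the clause output, has 8 more; the 16
in `Clause3.size` leaves room. -/
theorem Clause3.length_word_lt (c : Clause3) (o o' : Option (Fin 3)) :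
    ((c.gadget o).word o').length < c.size := by
  have h : ∀ j, (escape (c.lit j).var).length + 13 ≤ c.size := by
    intro j
    rw [length_escape, Clause3.size]
    fin_cases j <;> simp <;> omega
  rcases o with _ | i <;> rcases o' with _ | j
  · simp only [gadget, Option.elim, Gadget.word, List.length_cons, List.length_append,
      length_escape, Clause3.size]
    omega
  · have := h j
    simp only [gadget, Option.elim, Gadget.word, Gadget.copyWord, List.length_cons]
    omega
  · have := h i
    simp only [gadget, Option.elim, Gadget.word, List.length_cons]
    omega
  · have := h i
    simp only [gadget, Option.elim, Gadget.word, Gadget.copyWord, List.length_cons]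
    omega

/-! ### The instance of the query problem -/

noncomputable section

/-- A list of all elements of a finite type. -/
def enumeration (α : Type) [Fintype α] : List α := Finset.univ.toList

@[simp]
theorem mem_enumeration {α : Type} [Fintype α] (a : α) : a ∈ enumeration α := by
  simp [enumeration]

/-- The itemset of the nodes of a gate selected by `m`, with its frequency. -/
def Gadget.entry (G : Gadget) (m : Option (Fin 3) → Bool) : List ℕ × ℚ :=
  (((enumeration (Option (Fin 3))).filter m).map fun o => itemNumber (G.word o),
    gateFrequency G.gate m)

/-- A variable gate is listed again at every occurrence of its variable, so the machine need not
detect repetitions. -/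
def Clause3.entries (c : Clause3) : List (List ℕ × ℚ) :=
  (enumeration (Option (Fin 3))).flatMap fun o =>
    (enumeration (Option (Fin 3) → Bool)).map (c.gadget o).entry

def Clause3.outputs (c : Clause3) : List ℕ :=
  (enumeration (Option (Fin 3))).map fun o => itemNumber ((c.gadget o).word none)

/-- The query data of a formula. -/
def Formula3.queryData (φ : Formula3) : QueryData where
  K := 2 ^ (φ.map Clause3.size).sum
  family := φ.flatMap Clause3.entries
  query := φ.flatMap Clause3.outputs
  threshold := 0

theorem Clause3.holds_iff (t : ℕ → Bool) (c : Clause3) :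
    c.Holds t ↔ clauseGate c.signs (fun j => t (c.lit j).var) = true := by
  simp [Clause3.Holds, Literal.Holds, clauseGate, Clause3.signs, Clause3.lit, Fin.exists_fin_succ]

/-! ### Correctness of the instance. -/

namespace Formula3

variable (φ : Formula3)

/-- The gadgets of the clauses of a formula. -/
abbrev Gadgets : Type := {G : Gadget // ∃ c ∈ φ, ∃ o, c.gadget o = G}

theorem itemNumber_word_lt (G : φ.Gadgets) (o : Option (Fin 3)) :
    itemNumber (G.1.word o) < φ.queryData.K := by
  obtain ⟨_, c, hc, o', rfl⟩ := G
  refine (itemNumber_lt _).trans_le (Nat.pow_le_pow_right (by norm_num) ?_)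
  exact (c.length_word_lt o' o).trans_le
    (List.single_le_sum (by simp) _ (List.mem_map_of_mem hc))

def node (G : φ.Gadgets) (o : Option (Fin 3)) : Fin φ.queryData.K :=
  ⟨itemNumber (G.1.word o), φ.itemNumber_word_lt G o⟩

abbrev gate (G : φ.Gadgets) : (Fin 3 → Bool) → Bool := G.1.gate

theorem node_injective (G : φ.Gadgets) : Function.Injective (φ.node G) := fun o o' h =>
  G.1.word_injective (itemNumber_injective (by simpa [node] using h))

theorem node_none_injective (G G' : φ.Gadgets) (h : φ.node G none = φ.node G' none) : G = G' :=
  Subtype.ext (Gadget.word_none_injective (itemNumber_injective (by simpa [node] using h)))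

theorem node_none_ne (G G' : φ.Gadgets) (j : Fin 3) : φ.node G none ≠ φ.node G' (some j) :=
  fun h => Gadget.word_none_ne G.1 G'.1 j (itemNumber_injective (by simpa [node] using h))

theorem mem_family_iff (e : List ℕ × ℚ) :
    e ∈ φ.queryData.family ↔ ∃ (G : φ.Gadgets) (m : Option (Fin 3) → Bool), G.1.entry m = e := by
  simp only [queryData, Clause3.entries, List.mem_flatMap, List.mem_map, mem_enumeration,
    true_and]
  constructor
  · rintro ⟨c, hc, o, m, rfl⟩
    exact ⟨⟨_, c, hc, o, rfl⟩, m, rfl⟩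
  · rintro ⟨⟨_, c, hc, o, rfl⟩, m, rfl⟩
    exact ⟨c, hc, o, m, rfl⟩

theorem mem_query_iff (k : ℕ) :
    k ∈ φ.queryData.query ↔ ∃ G : φ.Gadgets, itemNumber (G.1.word none) = k := by
  simp only [queryData, Clause3.outputs, List.mem_flatMap, List.mem_map, mem_enumeration,
    true_and]
  constructor
  · rintro ⟨c, hc, o, rfl⟩
    exact ⟨⟨_, c, hc, o, rfl⟩, rfl⟩
  · rintro ⟨⟨_, c, hc, o, rfl⟩, rfl⟩
    exact ⟨c, hc, o, rfl⟩

theorem mem_itemset_query (k : Fin φ.queryData.K) :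
    k ∈ itemset φ.queryData.K φ.queryData.query ↔ ∃ G : φ.Gadgets, φ.node G none = k := by
  simp [itemset, mem_query_iff, node, Fin.ext_iff]

theorem mem_itemset_entry (G : φ.Gadgets) (m : Option (Fin 3) → Bool) (k : Fin φ.queryData.K) :
    k ∈ itemset φ.queryData.K (G.1.entry m).1 ↔ ∃ o, m o = true ∧ φ.node G o = k := by
  simp [itemset, Gadget.entry, node, Fin.ext_iff]

/-- A single law realizes all entries, so repeated entries and gates with common inputs need no
compatibility check. -/
theorem satisfies_gateLaw : φ.queryData.Satisfies (gateLaw φ.node φ.gate) := by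
  intro e he
  obtain ⟨G, m, rfl⟩ := (φ.mem_family_iff e).1 he
  exact frequency_gateLaw_gate φ.gate φ.node_injective φ.node_none_injective φ.node_none_ne G m _
    (φ.mem_itemset_entry G m)

/-- This gives both antimonotonicity and the frequencies on all subsets that determine the marginal
on a gate. -/
theorem exists_itemset_entry (G : φ.Gadgets) (T : Finset (Fin φ.queryData.K))
    (hT : ∀ k ∈ T, ∃ o, φ.node G o = k) :
    ∃ m, T = itemset φ.queryData.K (G.1.entry m).1 := by
  refine ⟨fun o => decide (φ.node G o ∈ T), ?_⟩
  ext k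
  rw [mem_itemset_entry]
  constructor
  · intro hk
    obtain ⟨o, rfl⟩ := hT k hk
    exact ⟨o, by simpa using hk, rfl⟩
  · rintro ⟨o, ho, rfl⟩
    simpa using ho

theorem admissible : φ.queryData.Admissible where
  family_lt e he i hi := by
    obtain ⟨G, m, rfl⟩ := (φ.mem_family_iff e).1 he
    simp only [Gadget.entry, List.mem_map] at hi
    obtain ⟨o, -, rfl⟩ := hi
    exact φ.itemNumber_word_lt G o
  query_lt i hi := by
    obtain ⟨G, rfl⟩ := (φ.mem_query_iff i).1 hi
    exact φ.itemNumber_word_lt G none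
  antimonotonic := by
    rintro _ ⟨e, he, rfl⟩ T hT
    obtain ⟨G, m, rfl⟩ := (φ.mem_family_iff e).1 he
    obtain ⟨m', h⟩ := φ.exists_itemset_entry G T fun k hk => by
      obtain ⟨o, -, ho⟩ := (φ.mem_itemset_entry G m k).1 (hT hk)
      exact ⟨o, ho⟩
    exact ⟨_, (φ.mem_family_iff _).2 ⟨G, m', rfl⟩, h⟩
  consistent := ⟨_, gateLaw_mem_distributions _ _, φ.satisfies_gateLaw⟩

/-- As the threshold is 0, `gateLaw` itself is a witness once some coins make all outputs 1: every
copy of `v` gets the coin value `t v`. -/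
theorem exceeds_of_satisfiable (h : φ.Satisfiable) : φ.queryData.Exceeds := by
  classical
  obtain ⟨t, ht⟩ := h
  refine ⟨_, gateLaw_mem_distributions _ _, φ.satisfies_gateLaw, ?_⟩
  let u : Fin φ.queryData.K → Bool := fun k =>
    decide (∃ v j, itemNumber (Gadget.copyWord v j) = k ∧ t v = true)
  have hu : ∀ (G : φ.Gadgets) v j, G.1.word (some j) = Gadget.copyWord v j →
      u (φ.node G (some j)) = t v := by
    intro G v j h
    rw [Bool.eq_iff_iff]
    simp only [u, decide_eq_true_eq, node, h, itemNumber_injective.eq_iff]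
    exact ⟨fun ⟨w, k, hw, h'⟩ => (Gadget.copyWord_inj hw).1 ▸ h', fun h' => ⟨v, j, rfl, h'⟩⟩
  rw [frequency_gateLaw]
  rw [show (φ.queryData.threshold : ℝ) = 0 from Rat.cast_zero]
  refine div_pos (Nat.cast_pos.2 (Finset.card_pos.2 ⟨u, ?_⟩)) (by positivity)
  simp only [Finset.mem_filter, Finset.mem_univ, true_and]
  intro k hk
  obtain ⟨G, rfl⟩ := (φ.mem_itemset_query k).1 hk
  rw [response_none _ φ.node_none_injective]
  obtain ⟨_, c, hc, o, rfl⟩ := G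
  cases o with
  | none =>
    have := (Clause3.holds_iff t c).1 (ht c hc)
    rw [← this]
    change clauseGate c.signs _ = _
    congr 1
    funext j
    exact hu _ _ _ rfl
  | some i =>
    change equalGate (fun j => u (φ.node ⟨_, c, hc, some i, rfl⟩ (some j))) = true
    simp only [equalGate, decide_eq_true_eq]
    constructor <;> exact (hu _ (c.lit i).var _ rfl).trans (hu _ (c.lit i).var _ rfl).symm

theorem satisfiable_of_exceeds (h : φ.queryData.Exceeds) : φ.Satisfiable := by
  classical
  obtain ⟨q, hq, hsat, hpos⟩ := h
  have hpos' : frequency q (itemset φ.queryData.K φ.queryData.query) ≠ 0 := by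
    intro h0
    rw [h0] at hpos
    simp [queryData] at hpos
  obtain ⟨ω, hm, hω⟩ := Finset.exists_ne_zero_of_sum_ne_zero hpos'
  simp only [Finset.mem_filter, Finset.mem_univ, true_and, mem_itemset_query,
    forall_exists_index, forall_apply_eq_imp_iff] at hm
  have hgate : ∀ G : φ.Gadgets, φ.gate G (fun j => ω (φ.node G (some j))) = true := by
    intro G
    rw [← hm G]
    refine (gate_of_frequency_eq φ.gate φ.node_none_injective φ.node_none_ne hq.1 G ?_ hω).symm
    intro T hT
    obtain ⟨m, rfl⟩ := φ.exists_itemset_entry G T fun k hk => by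
      simpa using hT hk
    have he := (φ.mem_family_iff _).2 ⟨G, m, rfl⟩
    rw [φ.satisfies_gateLaw _ he, hsat _ he]
  have hlt : ∀ c ∈ φ, ∀ i j, itemNumber (Gadget.copyWord (c.lit i).var j) < φ.queryData.K :=
    fun c hc i j => φ.itemNumber_word_lt ⟨_, c, hc, some i, rfl⟩ (some j)
  -- The assignment reads copy 0. For a variable outside `φ` this item may not exist, and the
  -- default does not matter.
  refine ⟨fun v => if h : itemNumber (Gadget.copyWord v 0) < φ.queryData.K then ω ⟨_, h⟩ else false,
    fun c hc => ?_⟩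
  have hc' := hgate ⟨_, c, hc, none, rfl⟩
  rw [Clause3.holds_iff, ← hc']
  change _ = clauseGate c.signs _
  congr 1
  funext i
  have hi : equalGate (fun j => ω (φ.node ⟨_, c, hc, some i, rfl⟩ (some j))) = true :=
    hgate ⟨_, c, hc, some i, rfl⟩
  simp only [equalGate, decide_eq_true_eq] at hi
  rw [dif_pos (hlt c hc i 0)]
  -- The clause gate reads copy `i`; the variable gate identifies it with copy 0.
  change ω (φ.node ⟨_, c, hc, some i, rfl⟩ (some 0)) = ω (φ.node ⟨_, c, hc, some i, rfl⟩ (some i))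
  fin_cases i
  · rfl
  · exact hi.1
  · exact hi.1.trans hi.2

end Formula3

end

namespace Prog

variable {κ : Type} [DecidableEq κ]

/-! ### Running programs within a given number of steps -/

/-- Started on the stacks `S`, the program `P` ends within `n` steps with stacks `T`. -/
def Runs (P : Prog κ) (S T : κ → List Γ') (n : ℕ) : Prop := ∃ m ≤ n, Run P S T m

theorem Runs.mono {P : Prog κ} {S T : κ → List Γ'} {m n : ℕ} (h : Runs P S T m) (hmn : m ≤ n) :
    Runs P S T n := by
  obtain ⟨k, hk, h⟩ := h
  exact ⟨k, hk.trans hmn, h⟩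

theorem Runs.congr {P : Prog κ} {S T T' : κ → List Γ'} {m n : ℕ} (h : Runs P S T m) (hT : T = T')
    (hmn : m ≤ n) : Runs P S T' n := hT ▸ h.mono hmn

theorem Runs.skip (S : κ → List Γ') : Runs skip S S 0 := ⟨0, le_rfl, .skip S⟩

theorem Runs.push (k : κ) (a : Γ') (S : κ → List Γ') :
    Runs (push k a) S (Function.update S k (a :: S k)) 1 := ⟨1, le_rfl, .push k a S⟩

theorem Runs.seq {P Q : Prog κ} {S T U : κ → List Γ'} {m n : ℕ} (h₁ : Runs P S T m)
    (h₂ : Runs Q T U n) : Runs (seq P Q) S U (m + n) := by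
  obtain ⟨k, hk, h₁⟩ := h₁
  obtain ⟨l, hl, h₂⟩ := h₂
  exact ⟨k + l, by omega, .seq h₁ h₂⟩

theorem Runs.pop_cons {k : κ} {f : Option Γ' → Prog κ} {S T : κ → List Γ'} {n : ℕ} {a : Γ'}
    {w : List Γ'} (hS : S k = a :: w) (h : Runs (f (some a)) (Function.update S k w) T n) :
    Runs (pop k f) S T (1 + n) := by
  obtain ⟨m, hm, h⟩ := h
  exact ⟨1 + m, by omega, .pop (by simpa [hS] using h)⟩

theorem Runs.loop_nil {k : κ} {exit : Option Γ' → Bool} {f : Option Γ' → Prog κ}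
    {S : κ → List Γ'} (hS : S k = []) (hs : exit none = true) : Runs (loop k exit f) S S 1 := by
  refine ⟨1, le_rfl, ?_⟩
  have h := Run.loop_last (k := k) (exit := exit) (f := f) (S := S) (by simpa [hS] using hs)
  have h' : Function.update S k (S k).tail = S := by
    rw [hS, List.tail_nil, ← hS, Function.update_eq_self]
  rwa [h'] at h

theorem Runs.loop_last {k : κ} {exit : Option Γ' → Bool} {f : Option Γ' → Prog κ}
    {S : κ → List Γ'} {a : Γ'} {w : List Γ'} (hS : S k = a :: w) (hs : exit (some a) = true) :
    Runs (loop k exit f) S (Function.update S k w) 1 := by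
  refine ⟨1, le_rfl, ?_⟩
  have h := Run.loop_last (k := k) (exit := exit) (f := f) (S := S) (by simpa [hS] using hs)
  simpa [hS] using h

theorem Runs.loop_next {k : κ} {exit : Option Γ' → Bool} {f : Option Γ' → Prog κ}
    {S T U : κ → List Γ'} {a : Γ'} {w : List Γ'} {m n : ℕ} (hS : S k = a :: w)
    (hs : exit (some a) = false) (h₁ : Runs (f (some a)) (Function.update S k w) T m)
    (h₂ : Runs (loop k exit f) T U n) : Runs (loop k exit f) S U (1 + m + n) := by
  obtain ⟨i, hi, h₁⟩ := h₁
  obtain ⟨j, hj, h₂⟩ := h₂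
  exact ⟨1 + i + j, by omega, .loop_next (by simpa [hS] using hs) (by simpa [hS] using h₁) h₂⟩

/-- Each step pushes at most one symbol, so running time bounds output length. -/
theorem Run.length_le {P : Prog κ} {S T : κ → List Γ'} {n : ℕ} (h : Run P S T n) (k : κ) :
    (T k).length ≤ (S k).length + n := by
  have tail : ∀ (S : κ → List Γ') (l : κ),
      (Function.update S l (S l).tail k).length ≤ (S k).length := by
    intro S l
    by_cases hl : k = l
    · subst hl; simp
    · simp [hl]
  induction h with
  | skip S => simp
  | push l a S =>
    by_cases hl : k = l
    · subst hl; simp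
    · simp [hl]
  | seq _ _ ih₁ ih₂ => omega
  | @pop l _ S _ _ _ ih => have := tail S l; omega
  | @loop_last l _ _ S _ => have := tail S l; omega
  | @loop_next l _ _ S _ _ _ _ _ _ _ ih₁ ih₂ => have := tail S l; omega

/-! ### Elementary programs -/

/-- Empty the stack `k`. -/
def clear (k : κ) : Prog κ := loop k Option.isNone fun _ => skip

/-- Move the content of `k` onto `l`. -/
def move (k l : κ) : Prog κ := loop k Option.isNone fun a => a.elim skip (push l)

/-- Move the content of `k` both onto `l` and onto `l'`. -/
def moveTwice (k l l' : κ) : Prog κ :=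
  loop k Option.isNone fun a => a.elim skip fun a => seq (push l a) (push l' a)

theorem update_eq_self_of_eq {k : κ} {w : List Γ'} {S : κ → List Γ'} (h : w = S k) :
    Function.update S k w = S := by rw [h, Function.update_eq_self]

theorem runs_clear (k : κ) (w : List Γ') : ∀ S : κ → List Γ', S k = w →
    Runs (clear k) S (Function.update S k []) (w.length + 1) := by
  induction w with
  | nil =>
    intro S hS
    rw [← hS, Function.update_eq_self]
    exact .mono (.loop_nil hS rfl) (by simp)
  | cons a w ih =>
    intro S hS
    have h := Runs.loop_next (f := fun _ => skip) hS rfl (.skip _)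
      (ih (Function.update S k w) (by simp))
    rw [Function.update_idem] at h
    exact h.mono (by simp; omega)

theorem runs_move {k l : κ} (hkl : k ≠ l) (w : List Γ') : ∀ S : κ → List Γ', S k = w →
    Runs (move k l) S (Function.update (Function.update S k []) l (w.reverse ++ S l))
      (2 * w.length + 1) := by
  induction w with
  | nil =>
    intro S hS
    have : Function.update (Function.update S k []) l ([].reverse ++ S l) = S := by
      simp [update_eq_self_of_eq hS.symm]
    rw [this]
    exact .mono (.loop_nil hS rfl) (by simp)
  | cons a w ih =>
    intro S hS
    have h := Runs.loop_next (f := fun a => a.elim skip (push l)) hS rfl (.push _ _ _)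
      (ih _ (by simp [hkl]))
    refine h.congr ?_ ?_
    · funext i
      by_cases h₁ : i = l
      · subst h₁; simp [hkl.symm]
      · by_cases h₂ : i = k
        · subst h₂; simp [h₁]
        · simp [h₁, h₂]
    · simp; omega

theorem runs_moveTwice {k l l' : κ} (hkl : k ≠ l) (hkl' : k ≠ l') (hll' : l ≠ l') (w : List Γ') :
    ∀ S : κ → List Γ', S k = w →
    Runs (moveTwice k l l') S (Function.update (Function.update (Function.update S k []) l
      (w.reverse ++ S l)) l' (w.reverse ++ S l')) (3 * w.length + 1) := by
  induction w with
  | nil =>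
    intro S hS
    have : Function.update (Function.update (Function.update S k []) l
      ([].reverse ++ S l)) l' ([].reverse ++ S l') = S := by
      simp [update_eq_self_of_eq hS.symm]
    rw [this]
    exact .mono (.loop_nil hS rfl) (by simp)
  | cons a w ih =>
    intro S hS
    have h := Runs.loop_next (f := fun a => a.elim skip fun a => seq (push l a) (push l' a)) hS rfl
      (.seq (.push _ _ _) (.push _ _ _)) (ih _ (by simp [hkl, hkl']))
    refine h.congr ?_ ?_
    · funext i
      by_cases h₀ : i = l'
      · subst h₀; simp [hkl'.symm, hll'.symm]
      · by_cases h₁ : i = l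
        · subst h₁; simp [hkl.symm, h₀]
        · by_cases h₂ : i = k
          · subst h₂; simp [h₁, h₀]
          · simp [h₁, h₂, h₀]
    · simp; omega

end Prog

/-! ### Templates -/

/-- Part of a template: a symbol, or the escaped digits of the variable of the `i`-th literal. -/
inductive Token
  | sym (a : Γ')
  | var (i : Fin 3)

namespace Token

/-- The text a token stands for. -/
def text (v : Fin 3 → List Γ') : Token → List Γ'
  | sym a => [a]
  | var i => v i

def texts (v : Fin 3 → List Γ') (l : List Token) : List Γ' := l.flatMap (text v)

@[simp]
theorem texts_nil (v : Fin 3 → List Γ') : texts v [] = [] := rfl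

@[simp]
theorem texts_sym_cons (v : Fin 3 → List Γ') (a : Γ') (l : List Token) :
    texts v (sym a :: l) = a :: texts v l := rfl

@[simp]
theorem texts_var_cons (v : Fin 3 → List Γ') (i : Fin 3) (l : List Token) :
    texts v (var i :: l) = v i ++ texts v l := rfl

@[simp]
theorem texts_append (v : Fin 3 → List Γ') (l m : List Token) :
    texts v (l ++ m) = texts v l ++ texts v m := by
  simp [texts]

@[simp]
theorem texts_map_sym (v : Fin 3 → List Γ') (l : List Γ') : texts v (l.map sym) = l := by
  induction l <;> simp_all

theorem texts_flatMap {α : Type} (v : Fin 3 → List Γ') (l : List α) (f : α → List Token) :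
    texts v (l.flatMap f) = l.flatMap fun a => texts v (f a) := by
  induction l <;> simp_all

end Token

open Token

/-- The escaped digits of the variables of a clause. -/
def Clause3.escapes (c : Clause3) (i : Fin 3) : List Γ' := (escape (c.lit i).var).map Γ'.bit

namespace Template

def copyWord (i j : Fin 3) : List Token :=
  [sym (.bit false), sym (.bit (decide (j = 1))), sym (.bit (decide (j = 2))), var i]

/-- The template of the words of the gadgets of a clause with signs `s`. -/
def word (s : Fin 3 → Bool) : Option (Fin 3) → Option (Fin 3) → List Token
  | none, none => [sym (.bit true), sym (.bit true), sym (.bit (s 0)), sym (.bit (s 1)),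
      sym (.bit (s 2)), var 0, var 1, var 2]
  | none, some j => copyWord j j
  | some i, none => [sym (.bit true), sym (.bit false), var i]
  | some i, some j => copyWord i j

/-- Templates see only the signs of the clause, so eight of them, fixed in the program, serve all
clauses. -/
theorem texts_word (c : Clause3) (o o' : Option (Fin 3)) :
    texts c.escapes (word c.signs o o') = ((c.gadget o).word o').map Γ'.bit := by
  cases o <;> cases o' <;>
    simp [word, copyWord, Clause3.gadget, Gadget.word, Gadget.copyWord, Clause3.escapes]

def number (s : Fin 3 → Bool) (o o' : Option (Fin 3)) : List Token :=
  word s o o' ++ [sym (.bit true), sym .comma]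

theorem texts_number (c : Clause3) (o o' : Option (Fin 3)) :
    texts c.escapes (number c.signs o o') = encNat (itemNumber ((c.gadget o).word o')) := by
  simp [number, texts_word, encNat_itemNumber]

noncomputable section

def gate (s : Fin 3 → Bool) (o : Option (Fin 3)) : (Fin 3 → Bool) → Bool :=
  o.elim (clauseGate s) fun _ => equalGate

theorem gate_signs (c : Clause3) (o : Option (Fin 3)) : gate c.signs o = (c.gadget o).gate := by
  cases o <;> rfl

def entry (s : Fin 3 → Bool) (o : Option (Fin 3)) (m : Option (Fin 3) → Bool) : List Token :=
  ((enumeration (Option (Fin 3))).filter m).flatMap (fun o' => sym .bra :: number s o o') ++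
    (Γ'.ket :: encRat (gateFrequency (gate s o) m)).map sym

/-- The frequency depends on the gate alone, so its digits are constants of the template. -/
theorem texts_entry (c : Clause3) (o : Option (Fin 3)) (m : Option (Fin 3) → Bool) :
    texts c.escapes (entry c.signs o m) = QueryData.encEntry ((c.gadget o).entry m) := by
  simp [entry, texts_flatMap, texts_number, QueryData.encEntry, Gadget.entry, encList,
    List.flatMap_map, gate_signs]

/-- The template of the part of the family that belongs to a clause with signs `s`. -/
def family (s : Fin 3 → Bool) : List Token :=
  (enumeration (Option (Fin 3))).flatMap fun o =>
    (enumeration (Option (Fin 3) → Bool)).flatMap fun m => sym .bra :: entry s o m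

theorem texts_family (c : Clause3) : texts c.escapes (family c.signs) =
    c.entries.flatMap fun e => Γ'.bra :: QueryData.encEntry e := by
  simp [family, texts_flatMap, texts_entry, Clause3.entries, List.flatMap_assoc, List.flatMap_map]

/-- The template of the part of the query that belongs to a clause with signs `s`. -/
def query (s : Fin 3 → Bool) : List Token :=
  (enumeration (Option (Fin 3))).flatMap fun o => sym .bra :: number s o none

theorem texts_query (c : Clause3) : texts c.escapes (query c.signs) =
    c.outputs.flatMap fun n => Γ'.bra :: encNat n := by
  simp [query, texts_flatMap, texts_number, Clause3.outputs, List.flatMap_map]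

end

end Template

/-! ### The program of the reduction -/

namespace Reduction

open Prog Token

inductive Stack
  | input
  | digits (i : Fin 3)
  | temp
  | size
  | family
  | query
  | output
  deriving DecidableEq, Fintype

open Stack

/-- The stacks with the given contents. -/
def contents (i : List Γ') (v : Fin 3 → List Γ') (s f q o : List Γ') : Stack → List Γ'
  | input => i
  | digits j => v j
  | temp => []
  | size => s
  | family => f
  | query => q
  | output => o

section

variable (i i' : List Γ') (v : Fin 3 → List Γ') (s f q o : List Γ')

@[simp]
theorem update_input : Function.update (contents i v s f q o) input i' = contents i' v s f q o := by
  funext k; cases k <;> simp [Function.update, contents]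

@[simp]
theorem update_var (j : Fin 3) :
    Function.update (contents i v s f q o) (digits j) i' = contents i (Function.update v j i') s f q o := by
  funext k
  cases k with
  | digits l => by_cases h : l = j <;> simp [Function.update, contents, h]
  | _ => simp [contents]

@[simp]
theorem update_size : Function.update (contents i v s f q o) size i' = contents i v i' f q o := by
  funext k; cases k <;> simp [Function.update, contents]

@[simp]
theorem update_family : Function.update (contents i v s f q o) family i' = contents i v s i' q o := by
  funext k; cases k <;> simp [Function.update, contents]

@[simp]
theorem update_query : Function.update (contents i v s f q o) query i' = contents i v s f i' o := by
  funext k; cases k <;> simp [Function.update, contents]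

@[simp]
theorem update_output : Function.update (contents i v s f q o) output i' = contents i v s f q i' := by
  funext k; cases k <;> simp [Function.update, contents]

end

/-- Append the text of a token to the content of the stack `k`. -/
def emitToken (k : Stack) : Token → Prog Stack
  | .sym a => push k a
  | .var i => seq (move (digits i) temp) (moveTwice temp (digits i) k)

/-- Append the text of a template to the content of the stack `k`. -/
def emit (k : Stack) (l : List Token) : Prog Stack :=
  l.foldr (fun t P => seq (emitToken k t) P) skip

/-- Stacks hold texts reversed. Moving the digits to `temp` and back restores them while a copy
lands on `k`, at cost `(2N + 1) + (3N + 1)`. -/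
theorem runs_emitToken {k : Stack} (hk : ∀ i, digits i ≠ k) (hk' : temp ≠ k) (t : Token) {N : ℕ}
    {S : Stack → List Γ'} (hS : S temp = []) (hN : ∀ i, (S (digits i)).length ≤ N) :
    Runs (emitToken k t) S
      (Function.update S k ((t.text fun i => (S (digits i)).reverse).reverse ++ S k))
      (5 * N + 2) := by
  cases t with
  | sym a => exact (Runs.push k a S).mono (by omega)
  | var i =>
    have h₁ := runs_move (k := digits i) (l := temp) (by simp) _ S rfl
    have h₂ := runs_moveTwice (k := temp) (l := digits i) (l' := k) (by simp) hk' (hk i) _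
      (Function.update (Function.update S (digits i) []) temp ((S (digits i)).reverse ++ S temp)) rfl
    have h := (h₁.seq h₂).mono (n := 5 * N + 2) (by have := hN i; simp [hS]; omega)
    refine h.congr ?_ le_rfl
    funext l
    by_cases h₀ : l = k
    · subst h₀
      simp [hS, (hk i).symm, hk'.symm, Token.text]
    · by_cases h₁ : l = digits i
      · subst h₁; simp [hS, h₀]
      · by_cases h₂ : l = temp
        · subst h₂; simp [h₀, hS]
        · simp [h₀, h₁, h₂]

theorem runs_emit {k : Stack} (hk : ∀ i, digits i ≠ k) (hk' : temp ≠ k) {N : ℕ} (l : List Token) :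
    ∀ S : Stack → List Γ', S temp = [] → (∀ i, (S (digits i)).length ≤ N) →
    Runs (emit k l) S
      (Function.update S k ((texts (fun i => (S (digits i)).reverse) l).reverse ++ S k))
      (l.length * (5 * N + 2)) := by
  induction l with
  | nil =>
    intro S _ _
    simpa [emit] using Runs.skip S
  | cons t l ih =>
    intro S hS hN
    have h₁ := runs_emitToken hk hk' t hS hN
    have h₂ := ih (Function.update S k ((t.text fun i => (S (digits i)).reverse).reverse ++ S k))
      (by rw [Function.update_of_ne hk', hS])
      (fun i => by rw [Function.update_of_ne (hk i)]; exact hN i)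
    have h := (h₁.seq h₂).mono (n := (t :: l).length * (5 * N + 2))
      (by rw [List.length_cons]; apply le_of_eq; ring)
    simpa [emit, hk, texts] using h

/-- Read a number up to its closing comma, store its escaped digits on `digits j`, and note two
digits on `size` for each digit. -/
def readVar (j : Fin 3) : Prog Stack :=
  seq (loop input (fun a => decide (a = none ∨ a = some .comma)) fun a => a.elim skip fun a =>
    seq (push (digits j) (.bit true)) (seq (push (digits j) a)
      (seq (push size (.bit false)) (push size (.bit false)))))
    (push (digits j) (.bit false))

theorem runs_readDigits (j : Fin 3) (w : List Bool) (r f q o : List Γ') :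
    ∀ (v : Fin 3 → List Γ') (s : List Γ'),
    Runs (loop input (fun a => decide (a = none ∨ a = some .comma)) fun a => a.elim skip fun a =>
      seq (push (digits j) (.bit true)) (seq (push (digits j) a)
        (seq (push size (.bit false)) (push size (.bit false)))))
      (contents (w.map Γ'.bit ++ .comma :: r) v s f q o)
      (contents r (Function.update v j (((w.flatMap fun b => [true, b]).map Γ'.bit).reverse ++ v j))
        (List.replicate (2 * w.length) (.bit false) ++ s) f q o)
      (5 * w.length + 1) := by
  induction w with
  | nil =>
    intro v s
    have h := Runs.loop_last (k := input)
      (exit := fun a => decide (a = none ∨ a = some Γ'.comma)) (f := fun a => a.elim skip fun a =>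
      seq (push (digits j) (.bit true)) (seq (push (digits j) a)
        (seq (push size (.bit false)) (push size (.bit false)))))
      (S := contents (.comma :: r) v s f q o) rfl (by simp)
    simpa using h
  | cons b w ih =>
    intro v s
    have h := Runs.loop_next (k := input)
      (exit := fun a => decide (a = none ∨ a = some Γ'.comma)) (f := fun a => a.elim skip fun a =>
      seq (push (digits j) (.bit true)) (seq (push (digits j) a)
        (seq (push size (.bit false)) (push size (.bit false)))))
      (S := contents (.bit b :: (w.map Γ'.bit ++ .comma :: r)) v s f q o) rfl (by simp)
      (.seq (.push _ _ _) (.seq (.push _ _ _) (.seq (.push _ _ _) (.push _ _ _))))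
      (by
        simp only [update_input, update_var, update_size]
        exact ih _ _)
    refine Eq.mp ?_ (h.mono (n := 5 * (b :: w).length + 1) (by simp; omega))
    congr 2
    · simp [contents]
    · rw [List.length_cons, Nat.mul_succ, ← List.replicate_append_replicate]
      simp [contents]

theorem runs_readVar (j : Fin 3) (n : ℕ) (r s f q o : List Γ') (v : Fin 3 → List Γ') :
    Runs (readVar j) (contents (encNat n ++ r) v s f q o)
      (contents r (Function.update v j (((escape n).map Γ'.bit).reverse ++ v j))
        (List.replicate (2 * (Computability.encodeNat n).length) (.bit false) ++ s) f q o)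
      (5 * (encNat n).length) := by
  have h := (runs_readDigits j (Computability.encodeNat n) r f q o v s).seq (.push (digits j) (.bit false) _)
  refine Eq.mp ?_ (h.mono (n := 5 * (encNat n).length) (by simp [encNat]; omega))
  simp [readVar, encNat, escape, contents]

/-- Emit the parts of the output that belong to a clause with signs `s`. -/
noncomputable def process (s : Fin 3 → Bool) : Prog Stack :=
  seq (emit size (List.replicate 16 (.sym (.bit false)))) <|
  seq (emit family (Template.family s)) <|
  seq (emit query (Template.query s)) <|
  seq (clear (digits 0)) <| seq (clear (digits 1)) (clear (digits 2))

/-- The number of tokens that are emitted for a clause with signs `s`. -/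
noncomputable def tokenCount (s : Fin 3 → Bool) : ℕ :=
  16 + (Template.family s).length + (Template.query s).length

theorem runs_process (c : Clause3) (r s f q o : List Γ') {N : ℕ}
    (hN : ∀ i, (c.escapes i).length ≤ N) :
    Runs (process c.signs) (contents r (fun i => (c.escapes i).reverse) s f q o)
      (contents r (fun _ => []) (List.replicate 16 (.bit false) ++ s)
        ((c.entries.flatMap fun e => Γ'.bra :: QueryData.encEntry e).reverse ++ f)
        ((c.outputs.flatMap fun n => Γ'.bra :: encNat n).reverse ++ q) o)
      (tokenCount c.signs * (5 * N + 2) + 3 * (N + 1)) := by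
  have hN' : ∀ i, (c.escapes i).reverse.length ≤ N := by simpa using hN
  have h₁ := runs_emit (k := size) (by simp) (by simp) (List.replicate 16 (.sym (.bit false)))
    (contents r (fun i => (c.escapes i).reverse) s f q o) rfl hN'
  rw [update_size] at h₁
  have h₂ := runs_emit (k := family) (by simp) (by simp) (Template.family c.signs)
    (contents r (fun i => (c.escapes i).reverse) (List.replicate 16 (.bit false) ++ s) f q o) rfl hN'
  rw [update_family] at h₂
  have h₃ := runs_emit (k := query) (by simp) (by simp) (Template.query c.signs)
    (contents r (fun i => (c.escapes i).reverse) (List.replicate 16 (.bit false) ++ s)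
      ((c.entries.flatMap fun e => Γ'.bra :: QueryData.encEntry e).reverse ++ f) q o) rfl hN'
  rw [update_query] at h₃
  have hc : ∀ j (v : Fin 3 → List Γ') (s f q : List Γ'), (v j).length ≤ N →
      Runs (clear (digits j)) (contents r v s f q o) (contents r (Function.update v j []) s f q o)
        (N + 1) := by
    intro j v s f q hj
    have := runs_clear (digits j) _ (contents r v s f q o) rfl
    rw [update_var] at this
    exact this.mono (by simpa [contents] using hj)
  simp only [contents, List.reverse_reverse] at h₁ h₂ h₃
  have ht : texts (fun i => c.escapes i) (List.replicate 16 (.sym (.bit false))) =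
      List.replicate 16 (.bit false) := rfl
  rw [ht, List.reverse_replicate] at h₁
  rw [show texts (fun i => c.escapes i) _ = _ from Template.texts_family c] at h₂
  rw [show texts (fun i => c.escapes i) _ = _ from Template.texts_query c] at h₃
  have h := h₁.seq (h₂.seq (h₃.seq ((hc 0 _ _ _ _ (hN' 0)).seq
    ((hc 1 _ _ _ _ (by simpa using hN 1)).seq (hc 2 _ _ _ _ (by simpa using hN 2))))))
  have hv : Function.update (Function.update (Function.update
      (fun i => (c.escapes i).reverse) 0 []) 1 []) 2 [] = fun _ : Fin 3 => ([] : List Γ') := by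
    funext i
    fin_cases i <;> rfl
  rw [hv] at h
  refine h.mono (le_of_eq ?_)
  rw [tokenCount, List.length_replicate]
  ring

/-- Is this symbol the digit one? -/
def isOne (a : Option Γ') : Bool := decide (a = some (.bit true))

@[simp]
theorem isOne_bit (b : Bool) : isOne (some (.bit b)) = b := by
  cases b <;> simp [isOne]

/-- Read a clause and emit what belongs to it. -/
noncomputable def clause : Prog Stack :=
  -- Nested `pop`s keep the three signs in the control state until the template is chosen.
  pop input fun a => seq (readVar 0) <| pop input fun b => seq (readVar 1) <|
  pop input fun c => seq (readVar 2) (process ![isOne a, isOne b, isOne c])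

/-- There are finitely many sign vectors, so the template lengths have a common bound `A`, and each
token costs time linear in the clause. -/
theorem exists_runs_clause : ∃ C, ∀ (c : Clause3) (r s f q o : List Γ'),
    Runs clause (contents (encClause3 c ++ r) (fun _ => []) s f q o)
      (contents r (fun _ => []) (List.replicate c.size (.bit false) ++ s)
        ((c.entries.flatMap fun e => Γ'.bra :: QueryData.encEntry e).reverse ++ f)
        ((c.outputs.flatMap fun n => Γ'.bra :: encNat n).reverse ++ q) o)
      (C * (encClause3 c).length) := by
  obtain ⟨A, hA⟩ : ∃ A, ∀ s, tokenCount s ≤ A :=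
    ⟨_, fun s => Finset.single_le_sum (f := tokenCount) (fun _ _ => Nat.zero_le _)
      (Finset.mem_univ s)⟩
  -- For a clause of length `L`, a token costs at most `10L + 2 ≤ 12L`; reading costs less than `5L`
  -- and clearing `6L + 3`.
  refine ⟨A * 12 + 20, fun c r s f q o => ?_⟩
  have hN : ∀ i, (c.escapes i).length ≤ 2 * (encClause3 c).length := by
    intro i
    rw [Clause3.escapes, List.length_map, length_escape]
    fin_cases i <;> simp [Clause3.lit, encClause3, encLiteral, encNat] <;> omega
  have he : encClause3 c ++ r = .bit c.fst.pos :: (encNat c.fst.var ++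
      .bit c.snd.pos :: (encNat c.snd.var ++ .bit c.thd.pos :: (encNat c.thd.var ++ r))) := by
    simp [encClause3, encLiteral]
  have hs : ![isOne (some (.bit c.fst.pos)), isOne (some (.bit c.snd.pos)),
      isOne (some (.bit c.thd.pos))] = c.signs := by
    funext i
    fin_cases i <;> simp [Clause3.signs, Clause3.lit]
  have hv : Function.update (Function.update (Function.update (fun _ : Fin 3 => ([] : List Γ'))
      0 (((escape c.fst.var).map Γ'.bit).reverse ++ []))
      1 (((escape c.snd.var).map Γ'.bit).reverse ++ []))
      2 (((escape c.thd.var).map Γ'.bit).reverse ++ []) = fun i => (c.escapes i).reverse := by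
    funext i
    fin_cases i <;> simp [Clause3.escapes, Clause3.lit]
  have hp := runs_process c r (List.replicate (2 * (Computability.encodeNat c.thd.var).length)
    (.bit false) ++ (List.replicate (2 * (Computability.encodeNat c.snd.var).length) (.bit false) ++
    (List.replicate (2 * (Computability.encodeNat c.fst.var).length) (.bit false) ++ s))) f q o hN
  rw [← hs, ← hv] at hp
  rw [he]
  have h := Runs.pop_cons (k := input) (f := fun a => seq (readVar 0) <| pop input fun b =>
      seq (readVar 1) <| pop input fun c => seq (readVar 2) (process ![isOne a, isOne b, isOne c]))
    (S := contents (.bit c.fst.pos :: (encNat c.fst.var ++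
      .bit c.snd.pos :: (encNat c.snd.var ++ .bit c.thd.pos :: (encNat c.thd.var ++ r))))
      (fun _ => []) s f q o) rfl (by
    rw [update_input]
    exact (runs_readVar 0 _ _ _ _ _ _ _).seq (.pop_cons rfl (by
      rw [update_input]
      exact (runs_readVar 1 _ _ _ _ _ _ _).seq (.pop_cons rfl (by
        rw [update_input]
        exact (runs_readVar 2 _ _ _ _ _ _ _).seq hp)))))
  refine Eq.mp ?_ (h.mono (n := (A * 12 + 20) * (encClause3 c).length) ?_)
  · rw [clause]
    congr 2
    simp only [← List.append_assoc, List.replicate_append_replicate]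
    congr 2
    simp only [Clause3.size, Clause3.lit, Matrix.cons_val]
    omega
  · rw [hs]
    have h₁ := Nat.mul_le_mul_right (5 * (2 * (encClause3 c).length) + 2) (hA c.signs)
    have h₂ : (encClause3 c).length = 3 + (encNat c.fst.var).length + (encNat c.snd.var).length +
        (encNat c.thd.var).length := by
      simp [encClause3, encLiteral]; omega
    have h₃ : A * (5 * (2 * (encClause3 c).length) + 2) ≤ A * (12 * (encClause3 c).length) :=
      Nat.mul_le_mul_left _ (by omega)
    have h₄ : (A * 12 + 20) * (encClause3 c).length =
        A * (12 * (encClause3 c).length) + 20 * (encClause3 c).length := by ring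
    omega

/-- Read all clauses and emit what belongs to them. -/
noncomputable def clauses : Prog Stack :=
  loop input (fun a => !decide (a = some .bra)) fun _ => clause

theorem exists_runs_clauses : ∃ C, ∀ (φ : Formula3) (s f q o : List Γ'),
    Runs clauses (contents (encList encClause3 φ) (fun _ => []) s f q o)
      (contents [] (fun _ => []) (List.replicate (φ.map Clause3.size).sum (.bit false) ++ s)
        (((φ.flatMap Clause3.entries).flatMap fun e => Γ'.bra :: QueryData.encEntry e).reverse ++ f)
        (((φ.flatMap Clause3.outputs).flatMap fun n => Γ'.bra :: encNat n).reverse ++ q) o)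
      (C * (encList encClause3 φ).length) := by
  obtain ⟨C, hC⟩ := exists_runs_clause
  refine ⟨C + 1, fun φ => ?_⟩
  induction φ with
  | nil =>
    intro s f q o
    have h := Runs.loop_last (k := input) (exit := fun a => !decide (a = some Γ'.bra))
      (f := fun _ => clause) (S := contents [.ket] (fun _ => []) s f q o) rfl (by simp)
    simpa [encList, clauses] using h.mono (n := C + 1) (by omega)
  | cons c φ ih =>
    intro s f q o
    have h := Runs.loop_next (k := input) (exit := fun a => !decide (a = some Γ'.bra))
      (f := fun _ => clause) (S := contents (.bra :: (encClause3 c ++ encList encClause3 φ))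
        (fun _ => []) s f q o) rfl (by simp)
      (by
        rw [update_input]
        exact hC c _ s f q o) (ih _ _ _ _)
    have hl : encList encClause3 (c :: φ) = .bra :: (encClause3 c ++ encList encClause3 φ) := by
      simp [encList]
    rw [hl]
    refine h.congr ?_ ?_
    · rw [List.map_cons, List.sum_cons, Nat.add_comm c.size, ← List.replicate_append_replicate,
        List.append_assoc]
      simp [-List.replicate_append_replicate]
    · simp only [List.length_cons, List.length_append]
      nlinarith

/-- Close the three parts of the output and join them. -/
def finish : Prog Stack :=
  seq (emit size [.sym (.bit true), .sym .comma]) <|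
  seq (emit family [.sym .ket]) <|
  seq (emit query ((Γ'.ket :: encRat 0).map .sym)) <|
  seq (move query output) <| seq (move family output) (move size output)

/-- Moving onto `output` undoes the reversal; the last part goes first because the top of the stack
is the start of the output. -/
theorem exists_runs_finish : ∃ D, ∀ s f q : List Γ',
    Runs finish (contents [] (fun _ => []) s f q [])
      (contents [] (fun _ => []) [] [] [] (s.reverse ++ ([.bit true, .comma] ++ (f.reverse ++
        ([.ket] ++ (q.reverse ++ (Γ'.ket :: encRat 0)))))))
      (2 * (s.length + f.length + q.length) + D) := by
  -- The digit stacks are empty, so each token costs 2. The 9 comes from moving the three closing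
  -- symbols of `size` and `family` and from ending three loops.
  refine ⟨2 * 2 + (2 + ((Γ'.ket :: encRat 0).length * 2 + 2 * (Γ'.ket :: encRat 0).length)) + 9,
    fun s f q => ?_⟩
  have h₁ := runs_emit (k := size) (N := 0) (by simp) (by simp) [.sym (.bit true), .sym .comma]
    (contents [] (fun _ => []) s f q []) rfl (fun _ => le_rfl)
  rw [update_size] at h₁
  have h₂ := runs_emit (k := family) (N := 0) (by simp) (by simp) [.sym .ket]
    (contents [] (fun _ => []) (.comma :: .bit true :: s) f q []) rfl (fun _ => le_rfl)
  rw [update_family] at h₂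
  have h₃ := runs_emit (k := query) (N := 0) (by simp) (by simp) ((Γ'.ket :: encRat 0).map .sym)
    (contents [] (fun _ => []) (.comma :: .bit true :: s) (.ket :: f) q []) rfl (fun _ => le_rfl)
  rw [update_query, texts_map_sym] at h₃
  have h₄ := runs_move (k := query) (l := output) (by simp) _
    (contents [] (fun _ => []) (.comma :: .bit true :: s) (.ket :: f)
      ((Γ'.ket :: encRat 0).reverse ++ q) []) rfl
  rw [update_query, update_output] at h₄
  have h₅ := runs_move (k := family) (l := output) (by simp) _
    (contents [] (fun _ => []) (.comma :: .bit true :: s) (.ket :: f)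
      [] (((Γ'.ket :: encRat 0).reverse ++ q).reverse ++ [])) rfl
  rw [update_family, update_output] at h₅
  have h₆ := runs_move (k := size) (l := output) (by simp) _
    (contents [] (fun _ => []) (.comma :: .bit true :: s) []
      [] ((Γ'.ket :: f).reverse ++ (((Γ'.ket :: encRat 0).reverse ++ q).reverse ++ []))) rfl
  rw [update_size, update_output] at h₆
  have h := h₁.seq (h₂.seq (h₃.seq (h₄.seq (h₅.seq h₆))))
  refine h.congr ?_ ?_
  · simp [contents]
  · simp only [contents, List.length_cons, List.length_append, List.length_reverse, List.length_map,
      List.length_nil]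
    omega

/-- The program of the reduction. -/
noncomputable def program : Prog Stack := seq clauses finish

theorem enc_queryData (φ : Formula3) : φ.queryData.enc =
    List.replicate (φ.map Clause3.size).sum (.bit false) ++ ([.bit true, .comma] ++
      ((φ.flatMap Clause3.entries).flatMap (fun e => Γ'.bra :: QueryData.encEntry e) ++
        ([.ket] ++ ((φ.flatMap Clause3.outputs).flatMap (fun n => Γ'.bra :: encNat n) ++
          (Γ'.ket :: encRat 0))))) := by
  simp [QueryData.enc, Formula3.queryData, encList, ← itemNumber_replicate, encNat_itemNumber]

theorem single_input (w : List Γ') :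
    single input w = contents w (fun _ => []) [] [] [] [] := by
  funext k; cases k <;> simp [single, contents]

theorem single_output (w : List Γ') :
    single output w = contents [] (fun _ => []) [] [] [] w := by
  funext k; cases k <;> simp [single, contents]

theorem exists_runs_program : ∃ C D, ∀ φ : Formula3,
    Runs program (single input (encList encClause3 φ)) (single output φ.queryData.enc)
      (C * (encList encClause3 φ).length + D) := by
  obtain ⟨C, hC⟩ := exists_runs_clauses
  obtain ⟨D, hD⟩ := exists_runs_finish
  -- The clauses take `C * L` steps, so each of three stacks has at most that length; `finish` adds
  -- twice their sum.
  refine ⟨7 * C, D, fun φ => ?_⟩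
  have h₁ := hC φ [] [] [] []
  have h₂ := hD (List.replicate (φ.map Clause3.size).sum (.bit false) ++ [])
    (((φ.flatMap Clause3.entries).flatMap fun e => Γ'.bra :: QueryData.encEntry e).reverse ++ [])
    (((φ.flatMap Clause3.outputs).flatMap fun n => Γ'.bra :: encNat n).reverse ++ [])
  have hlen : ∀ k, k ≠ input → (contents [] (fun _ => [])
      (List.replicate (φ.map Clause3.size).sum (.bit false) ++ [])
      (((φ.flatMap Clause3.entries).flatMap fun e => Γ'.bra :: QueryData.encEntry e).reverse ++ [])
      (((φ.flatMap Clause3.outputs).flatMap fun n => Γ'.bra :: encNat n).reverse ++ []) []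
      k).length ≤ C * (encList encClause3 φ).length := by
    intro k hk
    obtain ⟨n, hn, h⟩ := h₁
    have hk' : (contents (encList encClause3 φ) (fun _ => []) [] [] [] [] k).length = 0 := by
      cases k <;> first | rfl | exact absurd rfl hk
    have := h.length_le k
    omega
  have hs := hlen size (by simp)
  have hf := hlen family (by simp)
  have hq := hlen query (by simp)
  simp only [contents] at hs hf hq
  rw [single_input, single_output, enc_queryData]
  refine Eq.mp ?_ ((h₁.seq h₂).mono
    (n := 7 * C * (encList encClause3 φ).length + D) ?_)
  · simp [program]
  · rw [Nat.mul_assoc]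
    omega

end Reduction

theorem theorem3 : PolyTimeReducible ThreeSAT MaxQueryDec := by
  obtain ⟨C, D, h⟩ := Reduction.exists_runs_program
  -- The constant term `D + 1` includes the halting step.
  have hM : ∀ φ : Formula3, Nonempty (Turing.TM2OutputsInTime
      (Reduction.program.machine .input .output)
      ((encList encClause3 φ).map (Equiv.refl Γ').invFun)
      (some (φ.queryData.enc.map (Equiv.refl Γ').invFun))
      ((Polynomial.C C * Polynomial.X + Polynomial.C (D + 1) : Polynomial ℕ).eval
        (encList encClause3 φ).length)) := by
    intro φ
    have hid : ∀ l : List Γ', l.map (Equiv.refl Γ').invFun = l := fun l => List.map_id l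
    obtain ⟨n, hn, hr⟩ := h φ
    refine Eq.mpr (congrArg₂ (fun s t : List Γ' => Nonempty (Turing.TM2OutputsInTime
      (Reduction.program.machine .input .output) s (some t) _)) (hid _) (hid _))
      (Prog.machine_outputs hr ?_)
    simp only [Polynomial.eval_add, Polynomial.eval_mul, Polynomial.eval_C, Polynomial.eval_X]
    omega
  let M : Turing.TM2ComputableInPolyTime ThreeSAT.encode MaxQueryDec.encode
      (fun φ => ⟨Formula3.queryData φ, Formula3.admissible φ⟩) :=
    { tm := Reduction.program.machine .input .output
      inputAlphabet := Equiv.refl Γ'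
      outputAlphabet := Equiv.refl Γ'
      time := Polynomial.C C * Polynomial.X + Polynomial.C (D + 1)
      outputsFun := fun φ => (hM φ).some }
  exact ⟨_, M, fun _ => (inferInstance : Finite Γ'), fun φ =>
    ⟨Formula3.exceeds_of_satisfiable φ, Formula3.satisfiable_of_exceeds φ⟩⟩
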